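/- For a graph $G$ on vertex set $V$ let $L_+=\Delta+A$ be its unsigned Laplacian ($\Delta$ the diagonal matrix of degrees, $A$ the adjacency matrix) and let $U(t)=\exp(itL_+)$. For vertices $a\ne b$ and $c\ne d$ with $\{a,b\}\ne\{c,d\}$, at least one of the pairs $\{a,b\}$, $\{c,d\}$ being an edge of $G$, we say that there is perfect plus state transfer from $e_a+e_b$ to $e_c+e_d$ at time $t\ge 0$ if $U(t)(e_a+e_b)=\gamma(e_c+e_d)$ for some $\gamma\in\mathbb{C}$ with $|\gamma|=1$. The graph $G$ has perfect plus state transfer if this happens for some such pairs and some $t\ge0$ (transfer between two pairs that are both non-edges is not considered). Theorem. Let $P_n$ be the path on the vertices $1,\dots,n$. Then $P_n$ has perfect plus state transfer if and only if $n=3$ or $n=4$. In $P_3$ it occurs between the two edges $\{1,2\}$ and $\{2,3\}$ (in both directions) at time $\pi/2$, and in $P_4$ it occurs between the two end edges $\{1,2\}$ and $\{3,4\}$ (in both directions) at time $\sqrt2\,\pi/2$; in each case there is no perfect plus state transfer, at any time, between any other two pairs. -/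

import Mathlib

open scoped Matrix

/-- The unsigned Laplacian of a graph: degree matrix plus adjacency matrix. -/
noncomputable def unsignedLaplacian {V : Type*} [Fintype V] [DecidableEq V]
    (G : SimpleGraph V) [DecidableRel G.Adj] : Matrix V V ℂ :=
  G.degMatrix ℂ + G.adjMatrix ℂ

/-- The transition matrix `U(t) = exp(i t L₊)` of the continuous quantum walk on `G` generated by
the unsigned Laplacian. -/
noncomputable def unsignedTransitionMatrix {V : Type*} [Fintype V] [DecidableEq V]
    (G : SimpleGraph V) [DecidableRel G.Adj] (t : ℝ) : Matrix V V ℂ :=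
  NormedSpace.exp ((Complex.I * (t : ℂ)) • unsignedLaplacian G)

/-- The (unnormalized) plus state `e_a + e_b`. -/
def plusState {V : Type*} [DecidableEq V] (a b : V) : V → ℂ :=
  Pi.single a 1 + Pi.single b 1

/-- The walk maps `e_a + e_b` to `e_c + e_d` at time `t`, up to a phase. -/
def PlusStateMapsTo {V : Type*} [Fintype V] [DecidableEq V]
    (G : SimpleGraph V) [DecidableRel G.Adj] (a b c d : V) (t : ℝ) : Prop :=
  ∃ γ : ℂ, ‖γ‖ = 1 ∧ unsignedTransitionMatrix G t *ᵥ plusState a b = γ • plusState c d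

/-- Perfect plus state transfer from `e_a + e_b` to `e_c + e_d` at the non-negative time `t`, where
`{a, b}` and `{c, d}` are different pairs of distinct vertices and at least one of the two pairs
is an edge. (Transfer of a state to itself is periodicity, not state transfer, and transfer between
two non-edges is excluded by convention.) -/
def PerfectPlusStateTransferAt {V : Type*} [Fintype V] [DecidableEq V]
    (G : SimpleGraph V) [DecidableRel G.Adj] (a b c d : V) (t : ℝ) : Prop :=
  a ≠ b ∧ c ≠ d ∧ s(a, b) ≠ s(c, d) ∧ (G.Adj a b ∨ G.Adj c d) ∧ 0 ≤ t ∧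
    PlusStateMapsTo G a b c d t

/-- The graph `G` has perfect plus state transfer. -/
def HasPerfectPlusStateTransfer {V : Type*} [Fintype V] [DecidableEq V]
    (G : SimpleGraph V) [DecidableRel G.Adj] : Prop :=
  ∃ (a b c d : V) (t : ℝ), PerfectPlusStateTransferAt G a b c d t

/-! Since $U(t)$ is unitary and commutes with $L_+$, transfer preserves the energy $\langle x,
L_+x\rangle$, which for $e_a+e_b$ is $\deg a+\deg b$, plus $2$ if $a\sim b$. On a path with $n\ge3$
an edge has energy at least 5 and a non-edge at most 4, so both pairs are edges
(`pathGraph_transfer_adj`). The eigenvalues of $L_+$ are $2+2\cos(\pi j/n)$. The overlap of the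
$j$-th eigenvector with the $u$-th edge is $2\cos(\pi j/2n)\sin(\pi ju/n)$. Up to the phase
$e^{2it}$, edges thus evolve like vertices of $P_{n-1}$ under its adjacency matrix. For $n\ge5$
(`pathSpectrum_no_transfer`), $j=1$ forces mirror-image edges. Comparing $j$ with $n-j$ makes
$4t\cos(\pi j/n)/\pi$ an integer whenever $n\nmid ju$. The resulting rational ratios of cosines make
$\cos(\pi/n)$ rational, against Niven's theorem. For $n=3,4$ explicit eigenvectors give the
transfer. -/

theorem Matrix.exp_mulVec_of_mulVec_eq_smul {V : Type*} [Fintype V] [DecidableEq V]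
    {A : Matrix V V ℂ} {v : V → ℂ} {μ : ℂ} (h : A *ᵥ v = μ • v) :
    NormedSpace.exp A *ᵥ v = Complex.exp μ • v := by
  let _ : NormedRing (Matrix V V ℂ) := Matrix.linftyOpNormedRing
  let _ : NormedAlgebra ℂ (Matrix V V ℂ) := Matrix.linftyOpNormedAlgebra
  have hpow : ∀ k : ℕ, A ^ k *ᵥ v = μ ^ k • v := by
    intro k
    induction k with
    | zero => simp
    | succ k ih => rw [pow_succ, ← Matrix.mulVec_mulVec, h, Matrix.mulVec_smul, ih, smul_smul,
        pow_succ, mul_comm]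
  have h1 := NormedSpace.exp_series_hasSum_exp' (𝕂 := ℂ) A
  have h2 := NormedSpace.exp_series_hasSum_exp' (𝕂 := ℂ) μ
  let f : Matrix V V ℂ →ₗ[ℂ] (V → ℂ) := (Matrix.mulVecBilin ℂ ℂ).flip v
  have hf : Continuous f := f.continuous_of_finiteDimensional
  have h3 := h1.map f hf
  have h4 := h2.smul_const v
  refine h3.unique ?_
  rw [Complex.exp_eq_exp_ℂ]
  convert h4 using 2 with k
  simp [f, Matrix.mulVecBilin, hpow, smul_smul]

theorem star_plusState {V : Type*} [DecidableEq V] (a b : V) :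
    star (plusState a b) = plusState a b := by
  simp [plusState]

/-! ### Overlaps and energy on an arbitrary graph -/

section General

variable {V : Type*} [Fintype V] [DecidableEq V] (G : SimpleGraph V) [DecidableRel G.Adj]

theorem unsignedLaplacian_mulVec_apply (v : V → ℂ) (a : V) :
    (unsignedLaplacian G *ᵥ v) a = ∑ b ∈ G.neighborFinset a, (v a + v b) := by
  rw [unsignedLaplacian, Matrix.add_mulVec, Pi.add_apply, SimpleGraph.degMatrix_mulVec_apply,
    SimpleGraph.adjMatrix_mulVec_apply, Finset.sum_add_distrib]
  simp

theorem unsignedLaplacian_isSymm : (unsignedLaplacian G).IsSymm :=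
  (G.isSymm_degMatrix ℂ).add (G.isSymm_adjMatrix)

theorem unsignedLaplacian_isHermitian : (unsignedLaplacian G).IsHermitian :=
  (G.isHermitian_degMatrix ℂ).add (G.isHermitian_adjMatrix ℂ)

theorem unsignedTransitionMatrix_isSymm (t : ℝ) : (unsignedTransitionMatrix G t).IsSymm :=
  Matrix.IsSymm.exp ((unsignedLaplacian_isSymm G).smul _)

theorem unsignedTransitionMatrix_mulVec_eigenvector {v : V → ℂ} {μ : ℂ}
    (h : unsignedLaplacian G *ᵥ v = μ • v) (t : ℝ) :
    unsignedTransitionMatrix G t *ᵥ v = Complex.exp (Complex.I * t * μ) • v :=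
  Matrix.exp_mulVec_of_mulVec_eq_smul (by rw [Matrix.smul_mulVec, h, smul_smul])

theorem unsignedTransitionMatrix_conjTranspose (t : ℝ) :
    (unsignedTransitionMatrix G t)ᴴ = (unsignedTransitionMatrix G t)⁻¹ := by
  rw [unsignedTransitionMatrix, ← Matrix.exp_conjTranspose, ← Matrix.exp_neg,
    Matrix.conjTranspose_smul, (unsignedLaplacian_isHermitian G).eq, ← neg_smul]
  simp

theorem unsignedTransitionMatrix_conj_unsignedLaplacian (t : ℝ) :
    (unsignedTransitionMatrix G t)ᴴ * (unsignedLaplacian G * unsignedTransitionMatrix G t) =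
      unsignedLaplacian G := by
  have hc : Commute (unsignedLaplacian G) (unsignedTransitionMatrix G t) :=
    ((Commute.refl _).smul_right _).exp_right
  have hu : IsUnit (unsignedTransitionMatrix G t).det :=
    (Matrix.isUnit_iff_isUnit_det _).1 (Matrix.isUnit_exp _)
  rw [hc.eq, unsignedTransitionMatrix_conjTranspose, Matrix.nonsing_inv_mul_cancel_left _ _ hu]

theorem dotProduct_plusState (v : V → ℂ) (a b : V) : v ⬝ᵥ plusState a b = v a + v b := by
  simp [plusState, dotProduct_add]

variable {G}

/-- Pair the transfer equation with an eigenvector; as $U(t)$ is symmetric, it can act on the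
eigenvector instead. -/
theorem PlusStateMapsTo.overlap {a b c d : V} {t : ℝ} (h : PlusStateMapsTo G a b c d t) :
    ∃ γ : ℂ, ‖γ‖ = 1 ∧ ∀ (v : V → ℂ) (μ : ℂ), unsignedLaplacian G *ᵥ v = μ • v →
      Complex.exp (Complex.I * t * μ) * (v a + v b) = γ * (v c + v d) := by
  obtain ⟨γ, hγ, h⟩ := h
  refine ⟨γ, hγ, fun v μ hv => ?_⟩
  have h1 := congrArg (v ⬝ᵥ ·) h
  simp only [dotProduct_smul, dotProduct_plusState, Matrix.dotProduct_mulVec] at h1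
  rw [← Matrix.mulVec_transpose, (unsignedTransitionMatrix_isSymm G t).eq,
    unsignedTransitionMatrix_mulVec_eigenvector G hv] at h1
  simpa [mul_add] using h1

theorem plusState_energy {a b : V} (hab : a ≠ b) :
    plusState a b ⬝ᵥ unsignedLaplacian G *ᵥ plusState a b =
      ((G.degree a + G.degree b + if G.Adj a b then 2 else 0 : ℕ) : ℂ) := by
  rw [dotProduct_comm, dotProduct_plusState]
  simp only [plusState, Matrix.mulVec_add, Pi.add_apply, Matrix.mulVec_single_one,
    unsignedLaplacian, SimpleGraph.degMatrix, Matrix.col_apply, Matrix.add_apply,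
    Matrix.diagonal_apply, SimpleGraph.adjMatrix_apply, G.adj_comm b a]
  split_ifs <;> simp_all
  all_goals ring

/-- Conservation of energy: $U^*L_+U=L_+$, and the phase cancels in the quadratic form. -/
theorem PlusStateMapsTo.degree_add_degree {a b c d : V} {t : ℝ} (hab : a ≠ b) (hcd : c ≠ d)
    (h : PlusStateMapsTo G a b c d t) :
    (G.degree a + G.degree b + if G.Adj a b then 2 else 0) =
      G.degree c + G.degree d + if G.Adj c d then 2 else 0 := by
  obtain ⟨γ, hγ, h⟩ := h
  rw [← Nat.cast_inj (R := ℂ), ← plusState_energy hab, ← plusState_energy hcd]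
  have h1 : star (γ • plusState c d) ⬝ᵥ unsignedLaplacian G *ᵥ (γ • plusState c d) =
      plusState c d ⬝ᵥ unsignedLaplacian G *ᵥ plusState c d := by
    rw [star_smul, star_plusState, Matrix.mulVec_smul, smul_dotProduct, dotProduct_smul, smul_smul]
    have : star γ * γ = 1 := by
      have := Complex.conj_mul' γ
      simpa [hγ] using this
    rw [this, one_smul]
  rw [← h1, ← h, Matrix.star_mulVec, star_plusState, ← Matrix.dotProduct_mulVec,
    Matrix.mulVec_mulVec, Matrix.mulVec_mulVec, Matrix.mul_assoc,
    unsignedTransitionMatrix_conj_unsignedLaplacian]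

end General

/-! ### Spectrum of the path and reduction to edges -/

section Path

variable {n : ℕ} [DecidableRel (SimpleGraph.pathGraph n).Adj]

theorem pathGraph_sum_neighborFinset {M : Type*} [AddCommMonoid M] (k : Fin n) (F : ℕ → M) :
    ∑ l ∈ (SimpleGraph.pathGraph n).neighborFinset k, F l =
      (if k.val + 1 < n then F (k.val + 1) else 0) + if 0 < k.val then F (k.val - 1) else 0 := by
  have h1 : (SimpleGraph.pathGraph n).neighborFinset k =
      Finset.univ.filter fun l : Fin n => k.val + 1 = l.val ∨ l.val + 1 = k.val := by
    ext l
    simp [SimpleGraph.pathGraph_adj]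
  rw [h1, Finset.sum_filter, Fin.sum_univ_eq_sum_range
    (fun l => if k.val + 1 = l ∨ l + 1 = k.val then F l else 0)]
  -- At $k=0$ the truncated $k-1$ is $0$, so the inner guard must remove a spurious term.
  have h2 : ∀ l ∈ Finset.range n, (if k.val + 1 = l ∨ l + 1 = k.val then F l else 0) =
      (if k.val + 1 = l then F l else 0) +
        if k.val - 1 = l then (if 0 < k.val then F l else 0) else 0 := by
    intro l _
    split_ifs <;> first | omega | simp
  rw [Finset.sum_congr rfl h2, Finset.sum_add_distrib, Finset.sum_ite_eq, Finset.sum_ite_eq,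
    if_pos (Finset.mem_range.2 (by omega : k.val - 1 < n))]
  simp only [Finset.mem_range]

theorem pathGraph_degree (k : Fin n) : (SimpleGraph.pathGraph n).degree k =
    (if k.val + 1 < n then 1 else 0) + if 0 < k.val then 1 else 0 := by
  have h := pathGraph_sum_neighborFinset k (fun _ => 1)
  rwa [← Finset.card_eq_sum_ones] at h

theorem pathGraph_unsignedLaplacian_mulVec (F : ℕ → ℂ) (k : Fin n) :
    (unsignedLaplacian (SimpleGraph.pathGraph n) *ᵥ fun l => F l) k =
      (if k.val + 1 < n then F k + F (k.val + 1) else 0) +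
        if 0 < k.val then F k + F (k.val - 1) else 0 := by
  rw [unsignedLaplacian_mulVec_apply, pathGraph_sum_neighborFinset k (fun l => F k + F l)]

/-- Extended beyond both ends, the sine wave is odd about each boundary, so the terms of the missing
neighbours vanish and one three-term recurrence holds everywhere. -/
theorem pathGraph_unsignedLaplacian_eigenvector (j : ℕ) :
    unsignedLaplacian (SimpleGraph.pathGraph n) *ᵥ
        (fun k => ((Real.sin (Real.pi * j * (2 * (k.val : ℕ) + 1) / (2 * n)) : ℝ) : ℂ)) =
      ((2 + 2 * Real.cos (Real.pi * j / n) : ℝ) : ℂ) •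
        fun k => ((Real.sin (Real.pi * j * (2 * (k.val : ℕ) + 1) / (2 * n)) : ℝ) : ℂ) := by
  ext k
  rw [pathGraph_unsignedLaplacian_mulVec
    (fun k => ((Real.sin (Real.pi * j * (2 * (k : ℕ) + 1) / (2 * n)) : ℝ) : ℂ)) k]
  have hn : (n : ℝ) ≠ 0 := by
    have := k.isLt
    exact_mod_cast (show n ≠ 0 by omega)
  simp only [Pi.smul_apply, smul_eq_mul]
  have hk := k.isLt
  set x := Real.pi * j * (2 * (k.val : ℝ) + 1) / (2 * n) with hx
  set δ := Real.pi * j / n with hδ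
  have hup : (if k.val + 1 < n then
      ((Real.sin x : ℝ) : ℂ) +
        ((Real.sin (Real.pi * j * (2 * ((k.val + 1 : ℕ) : ℝ) + 1) / (2 * n)) : ℝ) : ℂ) else 0) =
      ((Real.sin x + Real.sin (x + δ) : ℝ) : ℂ) := by
    have e : Real.pi * j * (2 * ((k.val + 1 : ℕ) : ℝ) + 1) / (2 * n) = x + δ := by
      rw [hx, hδ]; push_cast; field_simp; ring
    rw [e]
    split_ifs with h
    · push_cast; rfl
    · have hkn : (k.val : ℝ) = n - 1 := by
        rw [eq_sub_iff_add_eq]; exact_mod_cast (show k.val + 1 = n by omega)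
      have e1 : x = j * Real.pi - δ / 2 := by
        rw [hx, hδ, hkn]; field_simp; ring
      have e2 : x + δ = j * Real.pi + δ / 2 := by rw [e1]; ring
      rw [e2, e1, Real.sin_add, Real.sin_sub, Real.sin_nat_mul_pi]
      simp
  have hdown : (if 0 < k.val then
      ((Real.sin x : ℝ) : ℂ) +
        ((Real.sin (Real.pi * j * (2 * ((k.val - 1 : ℕ) : ℝ) + 1) / (2 * n)) : ℝ) : ℂ) else 0) =
      ((Real.sin x + Real.sin (x - δ) : ℝ) : ℂ) := by
    split_ifs with h
    · have e : Real.pi * j * (2 * ((k.val - 1 : ℕ) : ℝ) + 1) / (2 * n) = x - δ := by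
        rw [hx, hδ, Nat.cast_sub (by omega)]; push_cast; field_simp; ring
      rw [e]; push_cast; rfl
    · have hk0 : (k.val : ℝ) = 0 := by exact_mod_cast (show k.val = 0 by omega)
      have e1 : x - δ = -x := by
        rw [hx, hδ, hk0]; field_simp; ring
      rw [e1, Real.sin_neg]; simp
  rw [hup, hdown, ← Complex.ofReal_add, ← Complex.ofReal_mul, Real.sin_add, Real.sin_sub]
  congr 1
  ring

theorem pathGraph_transfer_adj (hn : 3 ≤ n) {a b c d : Fin n} {t : ℝ}
    (h : PerfectPlusStateTransferAt (SimpleGraph.pathGraph n) a b c d t) :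
    ((a.val + 1 = b ∨ b.val + 1 = a) ∧ (c.val + 1 = d ∨ d.val + 1 = c)) ∧
      (SimpleGraph.pathGraph n).degree a + (SimpleGraph.pathGraph n).degree b =
      (SimpleGraph.pathGraph n).degree c + (SimpleGraph.pathGraph n).degree d := by
  obtain ⟨hab, hcd, -, hadj, -, hmap⟩ := h
  have hdeg := hmap.degree_add_degree hab hcd
  simp only [SimpleGraph.pathGraph_adj, pathGraph_degree] at *
  have hab' : a.val ≠ b.val := fun h => hab (Fin.ext h)
  have hcd' : c.val ≠ d.val := fun h => hcd (Fin.ext h)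
  have := a.isLt
  have := b.isLt
  have := c.isLt
  have := d.isLt
  by_cases h1 : a.val + 1 = b.val ∨ b.val + 1 = a.val <;>
    by_cases h2 : c.val + 1 = d.val ∨ d.val + 1 = c.val <;>
    simp only [h1, h2, if_true, if_false] at hdeg hadj ⊢
  · exact ⟨by simp, by omega⟩
  · exfalso
    split_ifs at hdeg <;> omega
  · exfalso
    split_ifs at hdeg <;> omega
  · simp at hadj

end Path

/-! ### Explicit transfer in $P_3$ and $P_4$ -/

theorem pathGraph_three_transfer [DecidableRel (SimpleGraph.pathGraph 3).Adj] :
    PerfectPlusStateTransferAt (SimpleGraph.pathGraph 3) 0 1 1 2 (Real.pi / 2) ∧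
      PerfectPlusStateTransferAt (SimpleGraph.pathGraph 3) 1 2 0 1 (Real.pi / 2) := by
  have h1 : unsignedLaplacian (SimpleGraph.pathGraph 3) *ᵥ (![1, 0, -1] : Fin 3 → ℂ) =
      (1 : ℂ) • (![1, 0, -1] : Fin 3 → ℂ) := by
    ext k
    rw [unsignedLaplacian_mulVec_apply, SimpleGraph.neighborFinset_eq_filter, Finset.sum_filter]
    fin_cases k <;> simp [Fin.sum_univ_three, SimpleGraph.pathGraph_adj]
  have h2 : unsignedLaplacian (SimpleGraph.pathGraph 3) *ᵥ (![1, 2, 1] : Fin 3 → ℂ) =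
      (3 : ℂ) • (![1, 2, 1] : Fin 3 → ℂ) := by
    ext k
    rw [unsignedLaplacian_mulVec_apply, SimpleGraph.neighborFinset_eq_filter, Finset.sum_filter]
    fin_cases k <;> simp [Fin.sum_univ_three, SimpleGraph.pathGraph_adj] <;> norm_num
  have u1 := unsignedTransitionMatrix_mulVec_eigenvector _ h1 (Real.pi / 2)
  have u2 := unsignedTransitionMatrix_mulVec_eigenvector _ h2 (Real.pi / 2)
  have e1 : Complex.exp (Complex.I * (Real.pi / 2 : ℝ) * 1) = Complex.I := by
    have : Complex.I * (Real.pi / 2 : ℝ) * 1 = Real.pi / 2 * Complex.I := by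
      push_cast; ring
    rw [this, Complex.exp_pi_div_two_mul_I]
  have e2 : Complex.exp (Complex.I * (Real.pi / 2 : ℝ) * 3) = -Complex.I := by
    have : Complex.I * (Real.pi / 2 : ℝ) * 3 = Real.pi / 2 * Complex.I + Real.pi * Complex.I := by
      push_cast; ring
    rw [this, Complex.exp_add, Complex.exp_pi_div_two_mul_I, Complex.exp_pi_mul_I]; ring
  rw [e1] at u1
  rw [e2] at u2
  have p1 : plusState (0 : Fin 3) 1 = (1 / 2 : ℂ) • ![1, 0, -1] + (1 / 2 : ℂ) • ![1, 2, 1] := by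
    ext k; fin_cases k <;> simp [plusState]
    all_goals norm_num
  have p2 : plusState (1 : Fin 3) 2 = (1 / 2 : ℂ) • ![1, 2, 1] - (1 / 2 : ℂ) • ![1, 0, -1] := by
    ext k; fin_cases k <;> simp [plusState]
    all_goals norm_num
  refine ⟨⟨by decide, by decide, by decide, Or.inl (by simp [SimpleGraph.pathGraph_adj]),
    by positivity, -Complex.I, by simp, ?_⟩, ⟨by decide, by decide, by decide,
    Or.inr (by simp [SimpleGraph.pathGraph_adj]), by positivity, -Complex.I, by simp, ?_⟩⟩
  · rw [p1, p2, Matrix.mulVec_add, Matrix.mulVec_smul, Matrix.mulVec_smul, u1, u2]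
    module
  · rw [p1, p2, Matrix.mulVec_sub, Matrix.mulVec_smul, Matrix.mulVec_smul, u1, u2]
    module

theorem pathGraph_four_transfer [DecidableRel (SimpleGraph.pathGraph 4).Adj] :
    PerfectPlusStateTransferAt (SimpleGraph.pathGraph 4) 0 1 2 3 (√2 * Real.pi / 2) ∧
      PerfectPlusStateTransferAt (SimpleGraph.pathGraph 4) 2 3 0 1 (√2 * Real.pi / 2) := by
  have hs : ((√2 : ℝ) : ℂ) * (√2 : ℝ) = 2 := by
    rw [← Complex.ofReal_mul, Real.mul_self_sqrt (by norm_num)]; norm_num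
  have hev : ∀ s : ℂ, s * s = 2 → unsignedLaplacian (SimpleGraph.pathGraph 4) *ᵥ
      (![1, 1 + s, 1 + s, 1] : Fin 4 → ℂ) = (2 + s) • (![1, 1 + s, 1 + s, 1] : Fin 4 → ℂ) := by
    intro s hs
    ext k
    rw [unsignedLaplacian_mulVec_apply, SimpleGraph.neighborFinset_eq_filter, Finset.sum_filter]
    fin_cases k <;> simp [Fin.sum_univ_four, SimpleGraph.pathGraph_adj]
    · ring
    · linear_combination -hs
    · linear_combination -hs
    · ring
  have h1 := hev _ hs
  have h2 := hev (-(√2 : ℝ)) (by rw [neg_mul_neg, hs])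
  have h3 : unsignedLaplacian (SimpleGraph.pathGraph 4) *ᵥ (![1, 1, -1, -1] : Fin 4 → ℂ) =
      (2 : ℂ) • (![1, 1, -1, -1] : Fin 4 → ℂ) := by
    ext k
    rw [unsignedLaplacian_mulVec_apply, SimpleGraph.neighborFinset_eq_filter, Finset.sum_filter]
    fin_cases k <;> simp [Fin.sum_univ_four, SimpleGraph.pathGraph_adj] <;> norm_num
  have u1 := unsignedTransitionMatrix_mulVec_eigenvector _ h1 (√2 * Real.pi / 2)
  have u2 := unsignedTransitionMatrix_mulVec_eigenvector _ h2 (√2 * Real.pi / 2)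
  have u3 := unsignedTransitionMatrix_mulVec_eigenvector _ h3 (√2 * Real.pi / 2)
  set γ := Complex.exp (Complex.I * (√2 * Real.pi / 2 : ℝ) * 2) with hγ
  -- The time is chosen so that $\sqrt2\,t=\pi$: both eigenvalues $2\pm\sqrt2$ acquire phase $-1$
  -- relative to $2$.
  have e1 : Complex.exp (Complex.I * (√2 * Real.pi / 2 : ℝ) * (2 + (√2 : ℝ))) = -γ := by
    have : Complex.I * (√2 * Real.pi / 2 : ℝ) * (2 + (√2 : ℝ)) =
        Complex.I * (√2 * Real.pi / 2 : ℝ) * 2 + Real.pi * Complex.I := by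
      push_cast
      linear_combination Complex.I * Real.pi / 2 * hs
    rw [this, Complex.exp_add, Complex.exp_pi_mul_I, hγ]; ring
  have e2 : Complex.exp (Complex.I * (√2 * Real.pi / 2 : ℝ) * (2 + -(√2 : ℝ))) = -γ := by
    have : Complex.I * (√2 * Real.pi / 2 : ℝ) * (2 + -(√2 : ℝ)) =
        Complex.I * (√2 * Real.pi / 2 : ℝ) * 2 - Real.pi * Complex.I := by
      push_cast
      linear_combination -Complex.I * Real.pi / 2 * hs
    rw [this, Complex.exp_sub, Complex.exp_pi_mul_I, hγ]; ring
  rw [e1] at u1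
  rw [e2] at u2
  have hnorm : ‖-γ‖ = 1 := by
    have : Complex.I * (√2 * Real.pi / 2 : ℝ) * 2 = (√2 * Real.pi : ℝ) * Complex.I := by
      push_cast; ring
    rw [norm_neg, hγ, this, Complex.norm_exp_ofReal_mul_I]
  set v1 : Fin 4 → ℂ := ![1, 1 + (√2 : ℝ), 1 + (√2 : ℝ), 1] with hv1
  set v2 : Fin 4 → ℂ := ![1, 1 + -(√2 : ℝ), 1 + -(√2 : ℝ), 1] with hv2
  have p1 : plusState (0 : Fin 4) 1 =
      (1 / 4 : ℂ) • v1 + (1 / 4 : ℂ) • v2 + (1 / 2 : ℂ) • ![1, 1, -1, -1] := by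
    ext k; fin_cases k <;> simp [plusState, hv1, hv2] <;> ring
  have p2 : plusState (2 : Fin 4) 3 =
      (1 / 4 : ℂ) • v1 + (1 / 4 : ℂ) • v2 - (1 / 2 : ℂ) • ![1, 1, -1, -1] := by
    ext k; fin_cases k <;> simp [plusState, hv1, hv2] <;> ring
  refine ⟨⟨by decide, by decide, by decide, Or.inl (by simp [SimpleGraph.pathGraph_adj]),
    by positivity, -γ, hnorm, ?_⟩, ⟨by decide, by decide, by decide,
    Or.inr (by simp [SimpleGraph.pathGraph_adj]), by positivity, -γ, hnorm, ?_⟩⟩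
  · rw [p1, p2, Matrix.mulVec_add, Matrix.mulVec_add, Matrix.mulVec_smul, Matrix.mulVec_smul,
      Matrix.mulVec_smul, u1, u2, u3]
    module
  · rw [p1, p2, Matrix.mulVec_sub, Matrix.mulVec_add, Matrix.mulVec_smul, Matrix.mulVec_smul,
      Matrix.mulVec_smul, u1, u2, u3]
    module

/-! ### Arithmetic of cosines and sines -/

theorem rat_of_cos_ratios {c : ℝ} (hc : 1 / 2 < c) (hc1 : c < 1) (hc2 : 0 < 2 * c ^ 2 - 1)
    {q r : ℚ} (hq : 2 * c ^ 2 - 1 = q * c)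
    (hr : 4 * c ^ 3 - 3 * c = r * c ∨ 16 * c ^ 5 - 20 * c ^ 3 + 5 * c = r * c) :
    ∃ x : ℚ, c = x := by
  have hc0 : c ≠ 0 := by positivity
  have hq0 : (q : ℝ) ≠ 0 := by
    intro h; rw [h] at hq; linarith
  have key : ∃ x : ℚ, c ^ 2 = x := by
    rcases hr with hr | hr
    · refine ⟨(r + 3) / 4, ?_⟩
      have : 4 * c ^ 2 - 3 = r := mul_right_cancel₀ hc0 (by linear_combination hr)
      push_cast; linarith
    · have h5 : 16 * c ^ 4 - 20 * c ^ 2 + 5 = r :=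
        mul_right_cancel₀ hc0 (by linear_combination hr)
      -- Squaring $2c^2-1=qc$ eliminates $c^4$. The coefficient vanishes only if $q^2=1$, i.e.
      -- $c^2\in\{1/4,1\}$, which is excluded.
      have h4 : (4 * (q : ℝ) ^ 2 - 4) * c ^ 2 = r - 1 := by
        have : (2 * c ^ 2 - 1) ^ 2 = (q * c) ^ 2 := by rw [hq]
        linear_combination h5 - 4 * this
      have hne : (4 * (q : ℝ) ^ 2 - 4) ≠ 0 := by
        intro h
        have : (2 * c ^ 2 - 1) ^ 2 = c ^ 2 := by
          rw [hq]; linear_combination c ^ 2 * h / 4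
        have h0 : (4 * c ^ 2 - 1) * (c ^ 2 - 1) = 0 := by linear_combination this
        rcases mul_eq_zero.1 h0 with h0 | h0 <;> nlinarith
      refine ⟨(r - 1) / (4 * q ^ 2 - 4), ?_⟩
      push_cast
      rw [eq_div_iff hne]; linarith
  obtain ⟨x, hx⟩ := key
  refine ⟨(2 * x - 1) / q, ?_⟩
  push_cast
  rw [eq_div_iff hq0, ← hx]; linarith

/-- Niven allows only $0,\pm1/2,\pm1$, but $0<\pi/n<\pi/3$ puts the cosine strictly between $1/2$
and $1$. -/
theorem not_rat_cos_pi_div {n : ℕ} (hn : 5 ≤ n) (x : ℚ) : Real.cos (Real.pi / n) ≠ x := by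
  intro h
  have hn' : (5 : ℝ) ≤ n := by exact_mod_cast hn
  have hpi := Real.pi_pos
  have h1 := niven (θ := Real.pi / n) ⟨1 / n, by push_cast; ring⟩ ⟨x, h⟩
  have hlt : Real.pi / n ≤ Real.pi / 5 := by gcongr
  have h2 : Real.cos (Real.pi / 3) < Real.cos (Real.pi / n) :=
    Real.cos_lt_cos_of_nonneg_of_le_pi (by positivity) (by linarith) (by linarith)
  have h3 : Real.cos (Real.pi / n) < Real.cos 0 :=
    Real.cos_lt_cos_of_nonneg_of_le_pi le_rfl (by linarith) (by positivity)
  rw [Real.cos_pi_div_three] at h2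
  rw [Real.cos_zero] at h3
  simp only [Set.mem_insert_iff, Set.mem_singleton_iff] at h1
  rcases h1 with h1 | h1 | h1 | h1 | h1 <;> linarith

theorem sin_pi_mul_div_eq_zero_iff {n : ℕ} (hn : n ≠ 0) (m : ℕ) :
    Real.sin (Real.pi * m / n) = 0 ↔ n ∣ m := by
  have hn' : (n : ℝ) ≠ 0 := by exact_mod_cast hn
  rw [Real.sin_eq_zero_iff]
  constructor
  · rintro ⟨k, hk⟩
    have h : (k * n : ℝ) = m := by
      field_simp at hk
      exact hk
    have h' : (k * n : ℤ) = m := by exact_mod_cast h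
    exact Int.natCast_dvd_natCast.1 ⟨k, by rw [← h', mul_comm]⟩
  · rintro ⟨k, rfl⟩
    refine ⟨k, ?_⟩
    push_cast
    field_simp

theorem eq_or_add_eq_of_sin_eq {n u w : ℕ} (hu : u < n) (hw : w < n)
    (h : Real.sin (Real.pi * u / n) = Real.sin (Real.pi * w / n)) (h0 : 0 < u + w) :
    u = w ∨ u + w = n := by
  have hn : (0 : ℝ) < n := by exact_mod_cast (show 0 < n by omega)
  have hpi := Real.pi_pos
  have h1 := Real.sin_sub_sin (Real.pi * u / n) (Real.pi * w / n)
  rw [h, sub_self] at h1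
  have h2 := mul_eq_zero.1 h1.symm
  have hul : (u : ℝ) < n := by exact_mod_cast hu
  have hwl : (w : ℝ) < n := by exact_mod_cast hw
  have hu0 : (0 : ℝ) ≤ u := by positivity
  have hw0 : (0 : ℝ) ≤ w := by positivity
  rcases h2 with h2 | h2
  · left
    have h3 : Real.sin ((Real.pi * u / n - Real.pi * w / n) / 2) = 0 := by linarith
    have e : (Real.pi * u / n - Real.pi * w / n) / 2 =
        Real.pi * ((u - w) / (2 * n)) := by
      field_simp
    have b1 : -1 < ((u : ℝ) - w) / (2 * n) := by
      rw [lt_div_iff₀ (by positivity)]; linarith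
    have b2 : ((u : ℝ) - w) / (2 * n) < 1 := by
      rw [div_lt_iff₀ (by positivity)]; linarith
    rw [Real.sin_eq_zero_iff_of_lt_of_lt (by rw [e]; nlinarith) (by rw [e]; nlinarith), e] at h3
    have : (u : ℝ) = w := by
      rw [mul_eq_zero, or_iff_right hpi.ne', div_eq_zero_iff, or_iff_left (by positivity)] at h3
      linarith
    exact_mod_cast this
  · right
    obtain ⟨k, hk⟩ := Real.cos_eq_zero_iff.1 h2
    have h3 : (u + w : ℝ) = (2 * k + 1) * n := by
      field_simp at hk
      linarith
    have h4 : (u + w : ℤ) = (2 * k + 1) * n := by exact_mod_cast h3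
    have h5 : 0 < 2 * k + 1 := by
      by_contra hk
      have : (2 * k + 1) * (n : ℤ) ≤ 0 := mul_nonpos_of_nonpos_of_nonneg (by omega) (by omega)
      omega
    have h6 : 2 * k + 1 < 2 := by
      by_contra hk
      have : 2 * (n : ℤ) ≤ (2 * k + 1) * (n : ℤ) :=
        mul_le_mul_of_nonneg_right (by omega) (by omega)
      omega
    have : 2 * k + 1 = 1 := by omega
    rw [this] at h4
    omega

/-! ### No transfer for $n\ge5$ -/

theorem pathSpectrum_no_transfer {n u w : ℕ} (hn : 5 ≤ n) (hu : 0 < u) (hun : u < n) (hw : 0 < w)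
    (hwn : w < n) (huw : u ≠ w) {t : ℝ} {γ : ℂ} (hγ : ‖γ‖ = 1)
    (h : ∀ j : ℕ, 0 < j → j < n →
      Complex.exp (Complex.I * t * (2 * Real.cos (Real.pi * j / n) : ℝ)) *
        (Real.sin (Real.pi * (j * u : ℕ) / n) : ℝ) =
      γ * (Real.sin (Real.pi * (j * w : ℕ) / n) : ℝ)) : False := by
  have hn0 : n ≠ 0 := by omega
  have hn' : (5 : ℝ) ≤ n := by exact_mod_cast hn
  have hpi := Real.pi_pos
  have habs : ∀ j : ℕ, 0 < j → j < n →
      |Real.sin (Real.pi * (j * u : ℕ) / n)| = |Real.sin (Real.pi * (j * w : ℕ) / n)| := by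
    intro j hj hjn
    have := congrArg norm (h j hj hjn)
    rwa [norm_mul, norm_mul, hγ, one_mul, Complex.norm_real, Complex.norm_real, mul_assoc,
      ← Complex.ofReal_mul, mul_comm Complex.I, Complex.norm_exp_ofReal_mul_I, one_mul,
      Real.norm_eq_abs, Real.norm_eq_abs] at this
  have hsum : u + w = n := by
    have h1 := habs 1 one_pos (by omega)
    rw [one_mul, one_mul, abs_of_nonneg, abs_of_nonneg] at h1
    · exact (eq_or_add_eq_of_sin_eq hun hwn h1 (by omega)).resolve_left huw
    all_goals
      refine Real.sin_nonneg_of_nonneg_of_le_pi (by positivity) ?_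
      rw [div_le_iff₀ (by positivity)]
      gcongr
  -- The two sines agree up to sign; squaring removes the sign.
  have hexp : ∀ j : ℕ, 0 < j → j < n → ¬ n ∣ j * u →
      Complex.exp (Complex.I * t * (2 * Real.cos (Real.pi * j / n) : ℝ)) ^ 2 = γ ^ 2 := by
    intro j hj hjn hd
    have hs : Real.sin (Real.pi * (j * u : ℕ) / n) ≠ 0 :=
      fun h0 => hd ((sin_pi_mul_div_eq_zero_iff hn0 _).1 h0)
    have hj' := h j hj hjn
    have hs' : ((Real.sin (Real.pi * (j * u : ℕ) / n) : ℝ) : ℂ) ≠ 0 := by exact_mod_cast hs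
    have hsq : ((Real.sin (Real.pi * (j * w : ℕ) / n) : ℝ) : ℂ) ^ 2 =
        ((Real.sin (Real.pi * (j * u : ℕ) / n) : ℝ) : ℂ) ^ 2 := by
      exact_mod_cast (sq_eq_sq_iff_abs_eq_abs _ _).2 (habs j hj hjn).symm
    refine mul_right_cancel₀ (pow_ne_zero 2 hs') ?_
    rw [← mul_pow, hj', mul_pow, hsq]
  have hint : ∀ j : ℕ, 0 < j → j < n → ¬ n ∣ j * u →
      ∃ m : ℤ, 4 * t / Real.pi * Real.cos (Real.pi * j / n) = m := by
    intro j hj hjn hd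
    have h1 := hexp j hj hjn hd
    have h2 := hexp (n - j) (by omega) (by omega) (by
      intro hd'
      apply hd
      have : (n - j) * u + j * u = n * u := by rw [← add_mul]; congr 1; omega
      exact (Nat.dvd_add_right hd').1 (this ▸ dvd_mul_right n u))
    have e : Real.cos (Real.pi * (n - j : ℕ) / n) = - Real.cos (Real.pi * j / n) := by
      rw [← Real.cos_pi_sub]
      congr 1
      rw [Nat.cast_sub hjn.le]
      field_simp
    rw [e, ← h1, ← Complex.exp_nat_mul, ← Complex.exp_nat_mul, Complex.exp_eq_exp_iff_exists_int] at h2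
    obtain ⟨m, hm⟩ := h2
    refine ⟨-m, ?_⟩
    have hm' : (Complex.I * (4 * t * Real.cos (Real.pi * j / n)  : ℝ)) =
        Complex.I * (-m * Real.pi : ℝ) := by
      push_cast at hm ⊢
      linear_combination -hm / 2
    have hm2 := Complex.ofReal_injective (mul_left_cancel₀ Complex.I_ne_zero hm')
    push_cast
    field_simp
    linarith
  have hd1 : ¬ n ∣ 1 * u := fun hd => by
    have := Nat.le_of_dvd (by omega) hd
    omega
  have hd2 : ¬ n ∣ 2 * u := by
    rintro ⟨k, hk⟩
    have : k < 2 := by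
      by_contra hk2
      have : n * 2 ≤ n * k := Nat.mul_le_mul_left n (by omega)
      omega
    interval_cases k <;> omega
  -- At $t=0$, mirror symmetry makes $j=1$ give $\gamma=1$ and $j=2$ give $\gamma=-1$.
  have ht : t ≠ 0 := by
    rintro rfl
    have h1 := h 1 one_pos (by omega)
    have h2 := h 2 two_pos (by omega)
    have e1 : Real.sin (Real.pi * (1 * w : ℕ) / n) = Real.sin (Real.pi * (1 * u : ℕ) / n) := by
      rw [← Real.sin_pi_sub]
      congr 1
      push_cast [← hsum]
      field_simp [show (u + w : ℝ) ≠ 0 by positivity]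
      ring
    have e2 : Real.sin (Real.pi * (2 * w : ℕ) / n) = -Real.sin (Real.pi * (2 * u : ℕ) / n) := by
      rw [← Real.sin_neg, ← Real.sin_add_two_pi (-_)]
      congr 1
      push_cast [← hsum]
      field_simp [show (u + w : ℝ) ≠ 0 by positivity]
      ring
    have hs1 : ((Real.sin (Real.pi * (1 * u : ℕ) / n) : ℝ) : ℂ) ≠ 0 := by
      exact_mod_cast fun h0 => hd1 ((sin_pi_mul_div_eq_zero_iff hn0 _).1 h0)
    have hs2 : ((Real.sin (Real.pi * (2 * u : ℕ) / n) : ℝ) : ℂ) ≠ 0 := by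
      exact_mod_cast fun h0 => hd2 ((sin_pi_mul_div_eq_zero_iff hn0 _).1 h0)
    rw [e1, Complex.ofReal_zero, mul_zero, zero_mul, Complex.exp_zero] at h1
    rw [e2, Complex.ofReal_zero, mul_zero, zero_mul, Complex.exp_zero, ← mul_right_cancel₀ hs1 h1,
      Complex.ofReal_neg, one_mul, one_mul] at h2
    exact hs2 (self_eq_neg.1 h2)
  have hcpos : ∀ x : ℝ, 0 ≤ x → x ≤ Real.pi * 2 / n → 0 < Real.cos x := by
    intro x hx0 hx
    have : Real.pi * 2 / n ≤ Real.pi * 2 / 5 := by gcongr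
    exact Real.cos_pos_of_mem_Ioo ⟨by linarith, by linarith⟩
  set θ := Real.pi / n with hθ
  have hθj : ∀ j : ℕ, Real.pi * j / n = j * θ := fun j => by rw [hθ]; ring
  have hθ0 : 0 < θ := by positivity
  have hθ5 : θ ≤ Real.pi / 5 := by rw [hθ]; gcongr
  obtain ⟨m1, hm1⟩ := hint 1 one_pos (by omega) hd1
  obtain ⟨m2, hm2⟩ := hint 2 two_pos (by omega) hd2
  have hT : 4 * t / Real.pi ≠ 0 := by positivity
  have hc1 : 1 / 2 < Real.cos θ := by
    rw [← Real.cos_pi_div_three]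
    exact Real.cos_lt_cos_of_nonneg_of_le_pi hθ0.le (by linarith) (by linarith)
  have hc1' : Real.cos θ < 1 := by
    rw [← Real.cos_zero]
    exact Real.cos_lt_cos_of_nonneg_of_le_pi le_rfl (by linarith) hθ0
  have hc2 : 0 < 2 * Real.cos θ ^ 2 - 1 := by
    rw [← Real.cos_two_mul]
    exact hcpos _ (by positivity) (by rw [hθ]; apply le_of_eq; ring)
  rw [hθj] at hm1 hm2
  rw [Nat.cast_one, one_mul] at hm1
  have hm10 : (m1 : ℝ) ≠ 0 := by rw [← hm1]; exact mul_ne_zero hT (by linarith)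
  have hratio : ∀ j : ℕ, 0 < j → j < n → ¬ n ∣ j * u →
      ∃ q : ℚ, Real.cos (j * θ) = q * Real.cos θ := by
    intro j hj hjn hd
    obtain ⟨m, hm⟩ := hint j hj hjn hd
    rw [hθj] at hm
    refine ⟨m / m1, ?_⟩
    push_cast
    rw [div_mul_eq_mul_div, eq_div_iff hm10]
    refine mul_left_cancel₀ hT ?_
    linear_combination m1 * hm - m * hm1
  obtain ⟨q, hq⟩ := hratio 2 two_pos (by omega) hd2
  have c5 : Real.cos (5 * θ) =
      16 * Real.cos θ ^ 5 - 20 * Real.cos θ ^ 3 + 5 * Real.cos θ := by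
    have e1 : Real.cos (5 * θ) = Real.cos (3 * θ + 2 * θ) := by ring_nf
    have e2 : Real.cos θ = Real.cos (3 * θ - 2 * θ) := by ring_nf
    have e3 := Real.cos_add (3 * θ) (2 * θ)
    have e4 := Real.cos_sub (3 * θ) (2 * θ)
    rw [← e1] at e3
    rw [← e2] at e4
    have e5 := Real.cos_three_mul θ
    have e6 := Real.cos_two_mul θ
    rw [e5, e6] at e3 e4
    linear_combination e3 + e4
  have hr : ∃ r : ℚ, 4 * Real.cos θ ^ 3 - 3 * Real.cos θ = r * Real.cos θ ∨
      16 * Real.cos θ ^ 5 - 20 * Real.cos θ ^ 3 + 5 * Real.cos θ = r * Real.cos θ := by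
    -- If $j=3$ has zero overlap, $j=5$ replaces it: $n\mid3u$ and $n\mid5u$ would give
    -- $n\mid6u-5u=u$.
    by_cases hd3 : n ∣ 3 * u
    · have h5n : 5 < n := by
        refine lt_of_le_of_ne hn ?_
        rintro rfl
        omega
      obtain ⟨r, hr⟩ := hratio 5 (by omega) h5n (fun hd5 => hd1 (by
        have h6 : n ∣ 5 * u + u := by
          have : 5 * u + u = 2 * (3 * u) := by ring
          rw [this]; exact hd3.mul_left 2
        rw [one_mul]; exact (Nat.dvd_add_right hd5).1 h6))
      refine ⟨r, Or.inr ?_⟩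
      rw [← c5]; exact_mod_cast hr
    · obtain ⟨r, hr⟩ := hratio 3 (by omega) (by omega) hd3
      refine ⟨r, Or.inl ?_⟩
      rw [← Real.cos_three_mul]; exact_mod_cast hr
  obtain ⟨r, hr⟩ := hr
  obtain ⟨x, hx⟩ := rat_of_cos_ratios hc1 hc1' hc2 (q := q)
    (by rw [← Real.cos_two_mul]; exact_mod_cast hq) hr
  exact not_rat_cos_pi_div hn x hx

theorem pathGraph_edge_overlap {n : ℕ} {a b : Fin n} (hab : a.val + 1 = b ∨ b.val + 1 = a) (j : ℕ) :
    Real.sin (Real.pi * j * (2 * (a.val : ℕ) + 1) / (2 * n)) +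
      Real.sin (Real.pi * j * (2 * (b.val : ℕ) + 1) / (2 * n)) =
    2 * Real.cos (Real.pi * j / (2 * n)) *
      Real.sin (Real.pi * (j * (min a.val b.val + 1) : ℕ) / n) := by
  have key : ∀ m : ℕ, Real.sin (Real.pi * j * (2 * (m : ℕ) + 1) / (2 * n)) +
      Real.sin (Real.pi * j * (2 * ((m + 1 : ℕ) : ℝ) + 1) / (2 * n)) =
      2 * Real.cos (Real.pi * j / (2 * n)) * Real.sin (Real.pi * (j * (m + 1) : ℕ) / n) := by
    intro m
    have hn : (n : ℝ) ≠ 0 := by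
      have := a.isLt
      exact_mod_cast (show n ≠ 0 by omega)
    have e1 : Real.pi * j * (2 * (m : ℕ) + 1) / (2 * n) =
        Real.pi * (j * (m + 1) : ℕ) / n - Real.pi * j / (2 * n) := by
      push_cast; field_simp; ring
    have e2 : Real.pi * j * (2 * ((m + 1 : ℕ) : ℝ) + 1) / (2 * n) =
        Real.pi * (j * (m + 1) : ℕ) / n + Real.pi * j / (2 * n) := by
      push_cast; field_simp
    rw [e1, e2, Real.sin_add, Real.sin_sub]; ring
  rcases hab with h | h
  · rw [← h, min_eq_left (by omega)]
    exact key _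
  · rw [← h, min_eq_right (by omega), add_comm]
    exact key _

theorem pathGraph_no_transfer {n : ℕ} [DecidableRel (SimpleGraph.pathGraph n).Adj] (hn : 5 ≤ n) :
    ¬ HasPerfectPlusStateTransfer (SimpleGraph.pathGraph n) := by
  rintro ⟨a, b, c, d, t, h⟩
  obtain ⟨⟨hab, hcd⟩, -⟩ := pathGraph_transfer_adj (by omega) h
  obtain ⟨-, -, hne, -, -, hmap⟩ := h
  obtain ⟨γ, hγ, hov⟩ := hmap.overlap
  have hne' : min a.val b.val + 1 ≠ min c.val d.val + 1 := by
    intro hm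
    apply hne
    rw [Sym2.eq_iff, Fin.ext_iff, Fin.ext_iff, Fin.ext_iff, Fin.ext_iff]
    omega
  -- The constant $2$ in the eigenvalues is absorbed into the phase.
  refine pathSpectrum_no_transfer (t := t) (γ := γ * Complex.exp (-(2 * t : ℝ) * Complex.I)) hn
    (Nat.succ_pos (min a.val b.val)) (by omega) (Nat.succ_pos (min c.val d.val)) (by omega) hne'
    ?_ fun j hj hjn => ?_
  · rw [norm_mul, hγ, ← Complex.ofReal_neg, Complex.norm_exp_ofReal_mul_I, one_mul]
  · have h1 := hov _ _ (pathGraph_unsignedLaplacian_eigenvector j)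
    simp only [← Complex.ofReal_add] at h1
    rw [pathGraph_edge_overlap hab, pathGraph_edge_overlap hcd] at h1
    have hcos : ((2 * Real.cos (Real.pi * j / (2 * n)) : ℝ) : ℂ) ≠ 0 := by
      have hpi := Real.pi_pos
      have hjn' : (j : ℝ) < n := by exact_mod_cast hjn
      have hj0 : (0 : ℝ) < j := by exact_mod_cast hj
      have hlt : Real.pi * j / (2 * n) < Real.pi / 2 := by
        rw [div_lt_div_iff₀ (by linarith) two_pos]
        nlinarith
      have := Real.cos_pos_of_mem_Ioo (x := Real.pi * j / (2 * n))
        ⟨lt_of_lt_of_le (neg_lt_zero.2 (half_pos hpi)) (by positivity), hlt⟩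
      exact_mod_cast (by positivity : 2 * Real.cos (Real.pi * j / (2 * n)) ≠ 0)
    have h2 : Complex.exp (Complex.I * t * (2 + 2 * Real.cos (Real.pi * j / n) : ℝ)) =
        Complex.exp (Complex.I * t * (2 * Real.cos (Real.pi * j / n) : ℝ)) *
          Complex.exp ((2 * t : ℝ) * Complex.I) := by
      rw [← Complex.exp_add]; congr 1; push_cast; ring
    have h3 : Complex.exp ((2 * t : ℝ) * Complex.I) *
        Complex.exp (-(2 * t : ℝ) * Complex.I) = 1 := by
      rw [← Complex.exp_add, neg_mul, add_neg_cancel, Complex.exp_zero]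
    rw [h2, Complex.ofReal_mul (2 * Real.cos (Real.pi * j / (2 * n))),
      Complex.ofReal_mul (2 * Real.cos (Real.pi * j / (2 * n)))] at h1
    refine mul_left_cancel₀ hcos ?_
    simp only [Nat.succ_eq_add_one]
    linear_combination Complex.exp (-(2 * t : ℝ) * Complex.I) * h1 -
      ((2 * Real.cos (Real.pi * j / (2 * n)) : ℝ) : ℂ) *
      Complex.exp (Complex.I * t * (2 * Real.cos (Real.pi * j / n) : ℝ)) *
      ((Real.sin (Real.pi * (j * (min a.val b.val + 1) : ℕ) / n) : ℝ) : ℂ) * h3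

theorem mainTheorem7 :
    (∀ (n : ℕ) [DecidableRel (SimpleGraph.pathGraph n).Adj],
      HasPerfectPlusStateTransfer (SimpleGraph.pathGraph n) ↔ n = 3 ∨ n = 4) ∧
    (∀ [DecidableRel (SimpleGraph.pathGraph 3).Adj],
      PerfectPlusStateTransferAt (SimpleGraph.pathGraph 3) 0 1 1 2 (Real.pi / 2) ∧
      PerfectPlusStateTransferAt (SimpleGraph.pathGraph 3) 1 2 0 1 (Real.pi / 2) ∧
      ∀ (a b c d : Fin 3) (t : ℝ),
        PerfectPlusStateTransferAt (SimpleGraph.pathGraph 3) a b c d t →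
          (s(a, b) = s(0, 1) ∧ s(c, d) = s(1, 2)) ∨
          (s(a, b) = s(1, 2) ∧ s(c, d) = s(0, 1))) ∧
    (∀ [DecidableRel (SimpleGraph.pathGraph 4).Adj],
      PerfectPlusStateTransferAt (SimpleGraph.pathGraph 4) 0 1 2 3 (√2 * Real.pi / 2) ∧
      PerfectPlusStateTransferAt (SimpleGraph.pathGraph 4) 2 3 0 1 (√2 * Real.pi / 2) ∧
      ∀ (a b c d : Fin 4) (t : ℝ),
        PerfectPlusStateTransferAt (SimpleGraph.pathGraph 4) a b c d t →
          (s(a, b) = s(0, 1) ∧ s(c, d) = s(2, 3)) ∨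
          (s(a, b) = s(2, 3) ∧ s(c, d) = s(0, 1))) := by
  refine ⟨fun n _ => ⟨fun h => ?_, ?_⟩, fun {_} => ?_, fun {_} => ?_⟩
  · by_contra hn
    rcases Nat.lt_or_ge n 5 with h5 | h5
    -- For $n\le2$ there are no two different pairs.
    · obtain ⟨a, b, c, d, t, hab, hcd, hne, -⟩ := h
      apply hne
      rw [Sym2.eq_iff, Fin.ext_iff, Fin.ext_iff, Fin.ext_iff, Fin.ext_iff]
      have hab' : a.val ≠ b.val := fun h => hab (Fin.ext h)
      have hcd' : c.val ≠ d.val := fun h => hcd (Fin.ext h)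
      omega
    · exact pathGraph_no_transfer h5 h
  · rintro (rfl | rfl)
    · exact ⟨0, 1, 1, 2, _, pathGraph_three_transfer.1⟩
    · exact ⟨0, 1, 2, 3, _, pathGraph_four_transfer.1⟩
  · refine ⟨pathGraph_three_transfer.1, pathGraph_three_transfer.2, fun a b c d t h => ?_⟩
    obtain ⟨⟨hab, hcd⟩, -⟩ := pathGraph_transfer_adj le_rfl h
    have hne := h.2.2.1
    simp only [ne_eq, Sym2.eq_iff, Fin.ext_iff, Fin.val_zero, Fin.val_one, Fin.val_two] at hne ⊢
    omega
  · refine ⟨pathGraph_four_transfer.1, pathGraph_four_transfer.2, fun a b c d t h => ?_⟩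
    obtain ⟨⟨hab, hcd⟩, hdeg⟩ := pathGraph_transfer_adj (by norm_num) h
    have hne := h.2.2.1
    -- Degree sums separate the middle edge (4) from the end edges (3).
    simp only [pathGraph_degree] at hdeg
    clear h
    revert a b c d
    decide
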